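/- Let $n\ge 1$, let $\tau\in(0,1)$ and $p\in(0,\infty)$, and let $w:\mathbb{R}^n\to[0,\infty)$ be a weight, i.e. a non-negative (Lebesgue) measurable function. Cubes are closed, nondegenerate, with sides parallel to the axes; $|\cdot|$ is Lebesgue measure and $w(Q)=\int_Q w$. For measurable $f:\mathbb{R}^n\to\mathbb{R}$ and a cube $Q$ put $$m^\tau_f(Q)=\sup\{\alpha\ge 0 : |Q\cap\{|f|\ge\alpha\}|\ge\tau|Q|\},\qquad \mathcal{M}^\tau f(x)=\sup_{Q\ni x}m^\tau_f(Q),$$ the last supremum being over all cubes $Q$ containing $x$. Theorem. The operator $\mathcal{M}^\tau$ is bounded on $L^p(w)$ if and only if $w\in A_\infty$. Here "bounded on $L^p(w)$" means that there is a finite constant $C$ such that for every measurable $f:\mathbb{R}^n\to\mathbb{R}$ with $\|f\|_{L^p(w)}=\left(\int|f|^p\,w\,dx\right)^{1/p}<\infty$, one has $\mathcal{M}^\tau f\in L^p(w)$ (in particular it is measurable with respect to the completion of $w\,dx$) and $\|\mathcal{M}^\tau f\|_{L^p(w)}\le C\|f\|_{L^p(w)}$. Further, $A_\infty=\bigcup_{1\le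 q<\infty}A_q$, where $w\in A_1$ if $$\sup_Q\frac{w(Q)}{|Q|}\,\|w^{-1}\|_{L^\infty(Q)}<\infty,$$ and, for $1<q<\infty$, $w\in A_q$ if $$\sup_Q\frac{w(Q)}{|Q|}\left(\frac{1}{|Q|}\int_Q w^{-1/(q-1)}\right)^{q-1}<\infty,$$ the suprema being over all cubes and computed in $[0,\infty]$ with $0^{-1}=0^{-1/(q-1)}=\infty$ and $0\cdot\infty=0$ (a convention that matters only for the weight that vanishes almost everywhere, which satisfies both sides). -/

import Mathlib

open MeasureTheory
open scoped ENNReal NNReal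

noncomputable section

namespace MedianMaximal

/-- Cubes in `ℝⁿ`: closed, nondegenerate, with sides parallel to the coordinate axes. -/
def IsCube {n : ℕ} (Q : Set (Fin n → ℝ)) : Prop :=
  ∃ (a : Fin n → ℝ) (l : ℝ), 0 < l ∧ Q = Set.Icc a (fun i => a i + l)

/-- The measure `w dx` of a weight `w : ℝⁿ → [0, ∞)`. -/
def weightMeasure {n : ℕ} (w : (Fin n → ℝ) → ℝ≥0) : Measure (Fin n → ℝ) :=
  volume.withDensity (fun x => (w x : ℝ≥0∞))

/-- The number `m_f^τ(Q) = sup {α ≥ 0 : |Q ∩ {|f| ≥ α}| / |Q| ≥ τ}`. -/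
def level {n : ℕ} (τ : ℝ) (f : (Fin n → ℝ) → ℝ) (Q : Set (Fin n → ℝ)) : ℝ≥0∞ :=
  ⨆ (α : ℝ≥0) (_ : ENNReal.ofReal τ ≤ volume (Q ∩ {x | (α : ℝ) ≤ |f x|}) / volume Q), (α : ℝ≥0∞)

/-- The maximal operator `𝓜^τ f (x) = sup_{Q ∋ x} m_f^τ(Q)`, with values in `[0, ∞]`. -/
def levelMaximal {n : ℕ} (τ : ℝ) (f : (Fin n → ℝ) → ℝ) (x : Fin n → ℝ) : ℝ≥0∞ :=
  ⨆ (Q : Set (Fin n → ℝ)) (_ : IsCube Q) (_ : x ∈ Q), level τ f Q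

/-- `𝓜^τ` is bounded on `L^p(w)`: it maps every Lebesgue measurable `f` with `‖f‖_{L^p(w)} < ∞`
to an element of `L^p(w)`, with norm at most `C ‖f‖_{L^p(w)}`, where `C` does not depend on `f`. -/
def BoundedOnLp {n : ℕ} (τ p : ℝ) (w : (Fin n → ℝ) → ℝ≥0) : Prop :=
  ∃ C : ℝ≥0, ∀ f : (Fin n → ℝ) → ℝ, AEMeasurable f volume →
    eLpNorm f (ENNReal.ofReal p) (weightMeasure w) < ∞ →
      MemLp (levelMaximal τ f) (ENNReal.ofReal p) (weightMeasure w) ∧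
      eLpNorm (levelMaximal τ f) (ENNReal.ofReal p) (weightMeasure w)
        ≤ C * eLpNorm f (ENNReal.ofReal p) (weightMeasure w)

/-- `[w]_{A_1} = sup_Q (w(Q) / |Q|) ‖w⁻¹‖_{L^∞(Q)}`, computed in `[0, ∞]`
with `0⁻¹ = ∞` and `0 * ∞ = 0`. -/
def A1Const {n : ℕ} (w : (Fin n → ℝ) → ℝ≥0) : ℝ≥0∞ :=
  ⨆ (Q : Set (Fin n → ℝ)) (_ : IsCube Q),
    (weightMeasure w Q / volume Q) *
      essSup (fun x => (w x : ℝ≥0∞)⁻¹) (volume.restrict Q)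

/-- `[w]_{A_q} = sup_Q (w(Q) / |Q|) (σ(Q) / |Q|)^(q-1)` with `σ = w^(-1/(q-1))`, for `1 < q < ∞`,
computed in `[0, ∞]` with `0^(-1/(q-1)) = ∞` and `0 * ∞ = 0`. -/
def ApConst {n : ℕ} (q : ℝ) (w : (Fin n → ℝ) → ℝ≥0) : ℝ≥0∞ :=
  ⨆ (Q : Set (Fin n → ℝ)) (_ : IsCube Q),
    (weightMeasure w Q / volume Q) *
      ((∫⁻ x in Q, (w x : ℝ≥0∞) ^ (-1 / (q - 1))) / volume Q) ^ (q - 1)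

/-- The Muckenhoupt class `A_q`, `1 ≤ q < ∞`. -/
def IsAp {n : ℕ} (q : ℝ) (w : (Fin n → ℝ) → ℝ≥0) : Prop :=
  (q = 1 ∧ A1Const w < ∞) ∨ (1 < q ∧ ApConst q w < ∞)

/-- `A_∞` is the union of the classes `A_q`, `1 ≤ q < ∞`. -/
def IsAInfty {n : ℕ} (w : (Fin n → ℝ) → ℝ≥0) : Prop :=
  ∃ q : ℝ, IsAp q w

end MedianMaximal

end

section

open Metric Filter Topology

namespace MedianMaximal

variable {n : ℕ}

/-! Both sides are equivalent to `SubsetBound`: `w(B) ≤ K w(E)` for `E ⊆ B` with `|E| ≥ τ|B|`.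

Boundedness gives it by testing on `1_E`, since `𝓜^τ 1_E ≥ 1` on `B`. The `A_q` condition gives it
for every positive `τ`, by Hölder's inequality (`q > 1`) or a pointwise lower bound for `w` (`q =
1`).

Conversely, if `𝓜^τ f(x) > a`, then `{|f| > a}` has density at least `τ` in some cube containing
`x`. Vitali's covering lemma, `SubsetBound` and doubling yield `w{𝓜^τ f > a} ≤ DK w{|f| > a}`. The
height is the same on both sides, so the layer-cake formula gives every `L^p` bound without
interpolation.

The main point is that `SubsetBound` for one `τ < 1` implies `A_∞`. A set `E` of density below `τ`
in `B` can be enlarged inside `B` so that its volume grows by a factor `s > 1` while its weight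
grows by at most `1 + K` (`SubsetBound.exists_expansion`). Iterating lowers the density threshold
geometrically at a geometric cost in the constant. Hence the sets `{w ≤ β^{-k} w(B)/|B|}` decay
geometrically in volume, which bounds the average of `w^{-δ}` for small `δ`; this is `A_q` with `q =
1 + 1/δ`. -/

/-! ### Cubes as sup-norm balls, homotheties and density points -/

lemma closedBall_pi_eq_Icc (c : Fin n → ℝ) {r : ℝ} (hr : 0 ≤ r) :
    closedBall c r = Set.Icc (fun i => c i - r) (fun i => c i + r) := by
  rw [closedBall_pi c hr, ← Set.pi_univ_Icc]
  simp only [Real.closedBall_eq_Icc]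

lemma isCube_iff {Q : Set (Fin n → ℝ)} :
    IsCube Q ↔ ∃ (c : Fin n → ℝ) (r : ℝ), 0 < r ∧ Q = closedBall c r := by
  constructor
  · rintro ⟨a, l, hl, rfl⟩
    refine ⟨fun i => a i + l / 2, l / 2, by positivity, ?_⟩
    rw [closedBall_pi_eq_Icc _ (by positivity)]
    congr 1 <;> funext i <;> ring
  · rintro ⟨c, r, hr, rfl⟩
    refine ⟨fun i => c i - r, 2 * r, by positivity, ?_⟩
    rw [closedBall_pi_eq_Icc _ hr.le]
    congr 1; funext i; ring

lemma isCube_closedBall (c : Fin n → ℝ) {r : ℝ} (hr : 0 < r) : IsCube (closedBall c r) :=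
  isCube_iff.2 ⟨c, r, hr, rfl⟩

lemma volume_closedBall_mul (c c' : Fin n → ℝ) {t r : ℝ} (ht : 0 ≤ t) (hr : 0 ≤ r) :
    volume (closedBall c (t * r)) = ENNReal.ofReal (t ^ n) * volume (closedBall c' r) := by
  rw [Real.volume_pi_closedBall _ (by positivity), Real.volume_pi_closedBall _ hr,
    ← ENNReal.ofReal_mul (by positivity), Fintype.card_fin]
  congr 1
  rw [← mul_pow]; ring_nf

lemma volume_closedBall_pos (c : Fin n → ℝ) {r : ℝ} (hr : 0 < r) :
    volume (closedBall c r) ≠ 0 := (measure_closedBall_pos _ _ hr).ne'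

lemma volume_closedBall_ne_top (c : Fin n → ℝ) (r : ℝ) :
    volume (closedBall c r) ≠ ∞ := measure_closedBall_lt_top.ne

/-- The homothetic image of a ball with centre of homothety `x` and ratio `t`. -/
lemma closedBall_lineMap_subset {c x : Fin n → ℝ} {r s t : ℝ} (hx : x ∈ closedBall c r)
    (hst : s ≤ t) :
    closedBall (AffineMap.lineMap x c s) (s * r) ⊆ closedBall (AffineMap.lineMap x c t) (t * r) := by
  apply closedBall_subset_closedBall'
  rw [dist_lineMap_lineMap, Real.dist_eq, abs_sub_comm, abs_of_nonneg (sub_nonneg.2 hst)]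
  have h : (t - s) * dist x c ≤ (t - s) * r :=
    mul_le_mul_of_nonneg_left (mem_closedBall.1 hx) (sub_nonneg.2 hst)
  linarith

lemma mem_closedBall_lineMap {c x : Fin n → ℝ} {r s : ℝ} (hx : x ∈ closedBall c r)
    (hs : 0 ≤ s) : x ∈ closedBall (AffineMap.lineMap x c s) (s * r) := by
  rw [mem_closedBall, dist_left_lineMap, Real.norm_of_nonneg hs]
  exact mul_le_mul_of_nonneg_left (mem_closedBall.1 hx) hs

/-- Almost every point of `S` is a density point along the homothetic images of any ball
containing it. -/
lemma ae_tendsto_density_homothety (S : Set (Fin n → ℝ)) {ρ : ℝ} (h0 : 0 < ρ) (h1 : ρ < 1) :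
    ∀ᵐ x ∂volume.restrict S, ∀ (c : Fin n → ℝ) (r : ℝ), 0 < r → x ∈ closedBall c r →
      Tendsto (fun k : ℕ => volume (S ∩ closedBall (AffineMap.lineMap x c (ρ ^ k)) (ρ ^ k * r)) /
        volume (closedBall (AffineMap.lineMap x c (ρ ^ k)) (ρ ^ k * r))) atTop (𝓝 1) := by
  filter_upwards [IsUnifLocDoublingMeasure.ae_tendsto_measure_inter_div (volume) S 1] with x hx
  intro c r hr hxc
  refine hx _ _ ?_ ?_
  · refine tendsto_nhdsWithin_iff.2 ⟨?_, Eventually.of_forall fun k => ?_⟩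
    · simpa using (tendsto_pow_atTop_nhds_zero_of_lt_one h0.le h1).mul_const r
    · exact mul_pos (pow_pos h0 k) hr
  · refine Eventually.of_forall fun k => ?_
    rw [one_mul]
    exact mem_closedBall_lineMap hxc (pow_pos h0 k).le

/-- `μ(B) ≤ K μ(E)` for all cubes `B` and all measurable `E ⊆ B` with `|E| ≥ τ |B|`. -/
def SubsetBound (τ : ℝ) (K : ℝ≥0) (μ : Measure (Fin n → ℝ)) : Prop :=
  ∀ (c : Fin n → ℝ) (r : ℝ), 0 < r → ∀ E : Set (Fin n → ℝ), MeasurableSet E → E ⊆ closedBall c r →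
    ENNReal.ofReal τ * volume (closedBall c r) ≤ volume E → μ (closedBall c r) ≤ K * μ E

/-! ### Self-improvement of the subset bound -/

/-- A stopping-time argument: shrink the cube towards `x` and stop when the density of `E` first
reaches `τ`. The preceding cube has density below `τ` and is only `ρ^{-n}` times larger, whence the
upper bound. Homotheties centred at `x` keep every cube inside the original one. -/
lemma exists_closedBall_density {τ ρ : ℝ} (h0 : 0 < ρ) (h1 : ρ < 1) (hτ : τ < 1)
    {c : Fin n → ℝ} {r : ℝ} (hr : 0 < r) {E : Set (Fin n → ℝ)}
    (hE : E ⊆ closedBall c r) (hlt : volume E < ENNReal.ofReal τ * volume (closedBall c r))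
    {x : Fin n → ℝ} (hxE : x ∈ E)
    (hx : Tendsto (fun k : ℕ =>
        volume (E ∩ closedBall (AffineMap.lineMap x c (ρ ^ k)) (ρ ^ k * r)) /
        volume (closedBall (AffineMap.lineMap x c (ρ ^ k)) (ρ ^ k * r))) atTop (𝓝 1)) :
    ∃ (c' : Fin n → ℝ) (r' : ℝ), 0 < r' ∧ r' ≤ r ∧ x ∈ closedBall c' r' ∧
      closedBall c' r' ⊆ closedBall c r ∧
      ENNReal.ofReal τ * volume (closedBall c' r') ≤ volume (E ∩ closedBall c' r') ∧
      volume (E ∩ closedBall c' r') ≤ ENNReal.ofReal (τ / ρ ^ n) * volume (closedBall c' r') := by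
  classical
  set B : ℕ → Set (Fin n → ℝ) := fun k => closedBall (AffineMap.lineMap x c (ρ ^ k)) (ρ ^ k * r)
    with hB
  have hpos : ∀ k, 0 < ρ ^ k * r := fun k => by positivity
  have hex : ∃ k, ENNReal.ofReal τ * volume (B k) ≤ volume (E ∩ B k) := by
    have h : ∀ᶠ k in atTop, ENNReal.ofReal τ < volume (E ∩ B k) / volume (B k) :=
      hx.eventually_const_lt (by simpa using hτ)
    obtain ⟨k, hk⟩ := h.exists
    refine ⟨k, ?_⟩
    exact ((ENNReal.le_div_iff_mul_le (Or.inl (volume_closedBall_pos _ (hpos k)))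
      (Or.inl (volume_closedBall_ne_top _ _))).1 hk.le)
  have hB0 : B 0 = closedBall c r := by simp [hB]
  have hk0 : Nat.find hex ≠ 0 := by
    intro h
    have := Nat.find_spec hex
    rw [h, hB0, Set.inter_eq_left.2 hE] at this
    exact absurd this (not_le.2 hlt)
  obtain ⟨k, hk⟩ := Nat.exists_eq_succ_of_ne_zero hk0
  have hmin := Nat.find_min hex (m := k) (by omega)
  have hspec := Nat.find_spec hex
  rw [hk] at hspec
  have hle : ρ ^ (k + 1) ≤ ρ ^ k := pow_le_pow_of_le_one h0.le h1.le (Nat.le_succ k)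
  have hxB : x ∈ closedBall c r := hE hxE
  refine ⟨_, _, hpos (k + 1), ?_, mem_closedBall_lineMap hxB (by positivity), ?_, hspec, ?_⟩
  · exact mul_le_of_le_one_left hr.le (pow_le_one₀ h0.le h1.le)
  · have := closedBall_lineMap_subset hxB (pow_le_one₀ (n := k + 1) h0.le h1.le)
    simpa using this
  · calc volume (E ∩ B (k + 1)) ≤ volume (E ∩ B k) :=
          measure_mono (Set.inter_subset_inter_right _ (closedBall_lineMap_subset hxB hle))
      _ ≤ ENNReal.ofReal τ * volume (B k) := (not_le.1 hmin).le
      _ = ENNReal.ofReal (τ / ρ ^ n) * volume (B (k + 1)) := by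
        have e : volume (B (k + 1)) = ENNReal.ofReal (ρ ^ n) * volume (B k) := by
          simp only [hB]
          rw [pow_succ', mul_assoc]
          exact volume_closedBall_mul _ _ h0.le (hpos k).le
        rw [e, ← mul_assoc, mul_comm (ENNReal.ofReal (τ / ρ ^ n)),
          ← ENNReal.ofReal_mul (by positivity), mul_div_cancel₀ _ (by positivity)]

lemma measurableSet_closedBall_biUnion {u : Set ((Fin n → ℝ) × ℝ)} (hu : u.Countable) :
    MeasurableSet (⋃ a ∈ u, closedBall a.1 a.2) :=
  MeasurableSet.biUnion hu fun _ _ => measurableSet_closedBall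

/-- The Vitali covering lemma for a bounded family of cubes: a countable disjoint subfamily whose
fivefold enlargements cover. -/
lemma exists_vitali_subfamily (t : Set ((Fin n → ℝ) × ℝ)) {R : ℝ} (ht : ∀ a ∈ t, 0 < a.2 ∧ a.2 ≤ R) :
    ∃ u ⊆ t, u.Countable ∧ (u.PairwiseDisjoint fun a => closedBall a.1 a.2) ∧
      (⋃ a ∈ t, closedBall a.1 a.2) ⊆ ⋃ a ∈ u, closedBall a.1 (5 * a.2) := by
  obtain ⟨u, hut, hd, hc⟩ := Vitali.exists_disjoint_subfamily_covering_enlargement_closedBall t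
    (fun a => a.1) (fun a => a.2) R (fun a ha => (ht a ha).2) 5 (by norm_num)
  refine ⟨u, hut, ?_, hd, ?_⟩
  · refine hd.countable_of_nonempty_interior fun a ha => ?_
    exact ⟨a.1, ball_subset_interior_closedBall (mem_ball_self (ht a (hut ha)).1)⟩
  · refine Set.iUnion₂_subset fun a ha => ?_
    obtain ⟨b, hb, hab⟩ := hc a ha
    exact hab.trans (Set.subset_biUnion_of_mem (u := fun a : (Fin n → ℝ) × ℝ =>
      closedBall a.1 (5 * a.2)) hb)

/-- Add to `E` a disjoint Vitali family `V` of stopping cubes. Density at least `τ` in each cube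
controls `μ V` by `K μ E`; density at most `θ < 1` leaves a fraction `1 - θ` of `V` outside `E`, and
`|V| ≥ 5^{-n}|E|`. -/
lemma SubsetBound.exists_expansion {τ : ℝ} (hτ0 : 0 < τ) (hτ1 : τ < 1) {K : ℝ≥0}
    {μ : Measure (Fin n → ℝ)} (hμ : SubsetBound τ K μ) :
    ∃ s : ℝ, 1 < s ∧ ∀ (c : Fin n → ℝ) (r : ℝ), 0 < r → ∀ E : Set (Fin n → ℝ), MeasurableSet E →
      E ⊆ closedBall c r → volume E < ENNReal.ofReal τ * volume (closedBall c r) →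
      ∃ E', MeasurableSet E' ∧ E' ⊆ closedBall c r ∧
        ENNReal.ofReal s * volume E ≤ volume E' ∧ μ E' ≤ (1 + K) * μ E := by
  -- The shrinking ratio is taken so close to 1 that the stopping cubes still have density at most
  -- `θ = τ / ρ ^ n < 1`.
  obtain ⟨ρ, h0, h1, hρ⟩ : ∃ ρ : ℝ, 0 < ρ ∧ ρ < 1 ∧ τ < ρ ^ n := by
    have hc : Tendsto (fun x : ℝ => x ^ n) (𝓝[<] 1) (𝓝 1) := by
      have : ContinuousAt (fun x : ℝ => x ^ n) 1 := by fun_prop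
      simpa [ContinuousAt] using this.tendsto.mono_left (nhdsWithin_le_nhds (s := Set.Iio 1))
    have ha : ∀ᶠ x : ℝ in 𝓝[<] 1, 0 < x :=
      nhdsWithin_le_nhds (lt_mem_nhds (by norm_num))
    obtain ⟨ρ, h, h', h''⟩ :=
      ((hc.eventually_const_lt hτ1).and (ha.and self_mem_nhdsWithin)).exists
    exact ⟨ρ, h', h'', h⟩
  set θ := τ / ρ ^ n with hθ
  have hθ1 : θ < 1 := (div_lt_one (by positivity)).2 hρ
  have hθ0 : 0 < θ := by positivity
  refine ⟨1 + (1 - θ) / 5 ^ n, lt_add_of_pos_right _ (div_pos (sub_pos.2 hθ1) (by positivity)), ?_⟩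
  intro c r hr E hE hEB hlt
  set t : Set ((Fin n → ℝ) × ℝ) := {a | 0 < a.2 ∧ a.2 ≤ r ∧ closedBall a.1 a.2 ⊆ closedBall c r ∧
      ENNReal.ofReal τ * volume (closedBall a.1 a.2) ≤ volume (E ∩ closedBall a.1 a.2) ∧
      volume (E ∩ closedBall a.1 a.2) ≤ ENNReal.ofReal θ * volume (closedBall a.1 a.2)} with ht
  obtain ⟨u, hut, hu, hd, hc⟩ := exists_vitali_subfamily t (R := r) (fun a ha => ⟨ha.1, ha.2.1⟩)
  set V := ⋃ a ∈ u, closedBall a.1 a.2 with hV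
  have hVm : MeasurableSet V := measurableSet_closedBall_biUnion hu
  have hVB : V ⊆ closedBall c r := Set.iUnion₂_subset fun a ha => (hut ha).2.2.1
  have hVsum : ∀ ν : Measure (Fin n → ℝ), ν V = ∑' a : u, ν (closedBall a.1.1 a.1.2) := fun ν =>
    measure_biUnion hu hd fun _ _ => measurableSet_closedBall
  have hEVsum : ∀ ν : Measure (Fin n → ℝ),
      ν (E ∩ V) = ∑' a : u, ν (E ∩ closedBall a.1.1 a.1.2) := fun ν => by
    rw [hV, Set.inter_iUnion₂]
    exact measure_biUnion hu (hd.mono fun _ => Set.inter_subset_right)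
      fun _ _ => hE.inter measurableSet_closedBall
  have hEV : volume E ≤ ENNReal.ofReal (5 ^ n) * volume V := by
    have hae : E ≤ᵐ[volume] (⋃ a ∈ u, closedBall a.1 (5 * a.2) : Set (Fin n → ℝ)) := by
      have := (ae_restrict_iff' hE).1 (ae_tendsto_density_homothety E h0 h1)
      filter_upwards [this] with x hx hxE
      obtain ⟨c', r', h⟩ := exists_closedBall_density h0 h1 hτ1 hr hEB hlt hxE
        (hx hxE c r hr (hEB hxE))
      exact hc (Set.mem_biUnion (x := (c', r')) ⟨h.1, h.2.1, h.2.2.2⟩ h.2.2.1)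
    calc volume E ≤ volume (⋃ a ∈ u, closedBall a.1 (5 * a.2) : Set (Fin n → ℝ)) :=
          measure_mono_ae hae
      _ ≤ ∑' a : u, volume (closedBall a.1.1 (5 * a.1.2)) := measure_biUnion_le _ hu _
      _ = ∑' a : u, ENNReal.ofReal (5 ^ n) * volume (closedBall a.1.1 a.1.2) :=
          tsum_congr fun a => volume_closedBall_mul _ _ (by norm_num) (hut a.2).1.le
      _ = _ := by rw [ENNReal.tsum_mul_left, hVsum]
  have hEVθ : volume (E ∩ V) ≤ ENNReal.ofReal θ * volume V := by
    rw [hEVsum, hVsum, ← ENNReal.tsum_mul_left]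
    exact ENNReal.tsum_le_tsum fun a => (hut a.2).2.2.2.2
  have hμV : μ V ≤ K * μ E := by
    calc μ V = ∑' a : u, μ (closedBall a.1.1 a.1.2) := hVsum μ
      _ ≤ ∑' a : u, K * μ (E ∩ closedBall a.1.1 a.1.2) := ENNReal.tsum_le_tsum fun a =>
          hμ _ _ (hut a.2).1 _ (hE.inter measurableSet_closedBall) Set.inter_subset_right
            (hut a.2).2.2.2.1
      _ = K * μ (E ∩ V) := by rw [ENNReal.tsum_mul_left, hEVsum]
      _ ≤ K * μ E := by gcongr; exact Set.inter_subset_left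
  refine ⟨E ∪ V, hE.union hVm, Set.union_subset hEB hVB, ?_, ?_⟩
  · have hVtop : volume V ≠ ∞ := measure_ne_top_of_subset hVB (volume_closedBall_ne_top _ _)
    have hEtop : volume E ≠ ∞ := measure_ne_top_of_subset hEB (volume_closedBall_ne_top _ _)
    have e1 : volume.real (E ∪ V) = volume.real E + volume.real V - volume.real (E ∩ V) := by
      rw [← measureReal_union_add_inter hVm hEtop hVtop]; ring
    have e2 : volume.real (E ∩ V) ≤ θ * volume.real V := by
      have := ENNReal.toReal_mono (ENNReal.mul_ne_top ENNReal.ofReal_ne_top hVtop) hEVθ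
      rwa [ENNReal.toReal_mul, ENNReal.toReal_ofReal hθ0.le] at this
    have e3 : volume.real E ≤ 5 ^ n * volume.real V := by
      have := ENNReal.toReal_mono (ENNReal.mul_ne_top ENNReal.ofReal_ne_top hVtop) hEV
      rwa [ENNReal.toReal_mul, ENNReal.toReal_ofReal (by positivity)] at this
    have e4 : (1 + (1 - θ) / 5 ^ n) * volume.real E ≤ volume.real (E ∪ V) := by
      have : (1 - θ) / 5 ^ n * volume.real E ≤ (1 - θ) * volume.real V := by
        rw [div_mul_eq_mul_div, div_le_iff₀ (by positivity)]
        nlinarith [sub_pos.2 hθ1]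
      rw [e1]; linarith
    have hUtop : volume (E ∪ V) ≠ ∞ := measure_union_ne_top hEtop hVtop
    rw [← ENNReal.ofReal_toReal hEtop, ← ENNReal.ofReal_toReal hUtop,
      ← ENNReal.ofReal_mul (by have := sub_pos.2 hθ1; positivity)]
    exact ENNReal.ofReal_le_ofReal e4
  · calc μ (E ∪ V) ≤ μ E + μ V := measure_union_le _ _
      _ ≤ μ E + K * μ E := by gcongr
      _ = _ := by ring

lemma SubsetBound.exists_iterate {τ : ℝ} (hτ0 : 0 < τ) (hτ1 : τ < 1) {K : ℝ≥0}
    {μ : Measure (Fin n → ℝ)} (hμ : SubsetBound τ K μ) :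
    ∃ s : ℝ, 1 < s ∧ ∀ k : ℕ, SubsetBound (τ / s ^ k) (K * (1 + K) ^ k) μ := by
  obtain ⟨s, hs, h⟩ := hμ.exists_expansion hτ0 hτ1
  have hs0 : 0 < s := by linarith
  refine ⟨s, hs, fun k => ?_⟩
  induction k with
  | zero => simpa using hμ
  | succ k ih =>
    intro c r hr E hE hEB hle
    -- A set that is already `τ`-dense needs no enlargement; otherwise one expansion brings the
    -- density up to the previous threshold.
    by_cases hlt : ENNReal.ofReal τ * volume (closedBall c r) ≤ volume E
    · refine (hμ c r hr E hE hEB hlt).trans ?_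
      gcongr
      exact le_mul_of_one_le_right' (one_le_pow₀ (by simp))
    · obtain ⟨E', hE', hE'B, hv, hμE'⟩ := h c r hr E hE hEB (not_le.1 hlt)
      have := ih c r hr E' hE' hE'B ?_
      · calc μ (closedBall c r) ≤ _ := this
          _ ≤ (K * (1 + K) ^ k : ℝ≥0) * ((1 + K) * μ E) := by gcongr
          _ = _ := by push_cast; ring
      · refine le_trans ?_ hv
        calc ENNReal.ofReal (τ / s ^ k) * volume (closedBall c r)
            = ENNReal.ofReal s * (ENNReal.ofReal (τ / s ^ (k + 1)) * volume (closedBall c r)) := by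
              rw [← mul_assoc, ← ENNReal.ofReal_mul hs0.le]
              congr 2
              field_simp
              rw [pow_succ]
          _ ≤ _ := by gcongr

/-! ### From `A_∞` to the subset bound -/

lemma weightMeasure_absolutelyContinuous (w : (Fin n → ℝ) → ℝ≥0) :
    weightMeasure w ≪ volume := withDensity_absolutelyContinuous _ _

lemma weightMeasure_apply (w : (Fin n → ℝ) → ℝ≥0) {E : Set (Fin n → ℝ)} (hE : MeasurableSet E) :
    weightMeasure w E = ∫⁻ x in E, (w x : ℝ≥0∞) := withDensity_apply _ hE

/-- The `A_1` condition says that `w(B)/|B|` is at most a constant times `w` almost everywhere on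
`B`; integrate this over `E`. -/
lemma A1Const.subsetBound {w : (Fin n → ℝ) → ℝ≥0} (h : A1Const w < ∞) {τ : ℝ} (hτ : 0 < τ) :
    ∃ K, SubsetBound τ K (weightMeasure w) := by
  have hτ' : ENNReal.ofReal τ ≠ 0 := by simpa using hτ
  refine ⟨(A1Const w / ENNReal.ofReal τ).toNNReal, fun c r hr E hE hEB hle => ?_⟩
  rw [ENNReal.coe_toNNReal (ENNReal.div_ne_top h.ne hτ')]
  set B := closedBall c r with hB
  have hV0 : volume B ≠ 0 := volume_closedBall_pos _ hr
  have hVt : volume B ≠ ∞ := volume_closedBall_ne_top _ _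
  have hA : weightMeasure w B / volume B *
      essSup (fun x => (w x : ℝ≥0∞)⁻¹) (volume.restrict B) ≤ A1Const w :=
    le_iSup₂_of_le B (isCube_closedBall c hr) le_rfl
  have hae : ∀ᵐ x ∂volume.restrict E, weightMeasure w B / volume B ≤ A1Const w * (w x : ℝ≥0∞) := by
    have := ae_mono (Measure.restrict_mono_set volume hEB)
      (ENNReal.ae_le_essSup (μ := volume.restrict B) (fun x => (w x : ℝ≥0∞)⁻¹))
    filter_upwards [this] with x hx
    rw [← ENNReal.div_le_iff_le_mul (Or.inr h.ne) (Or.inl ENNReal.coe_ne_top), div_eq_mul_inv]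
    exact (mul_le_mul_right hx _).trans hA
  have hint : weightMeasure w B / volume B * volume E ≤ A1Const w * weightMeasure w E := by
    rw [weightMeasure_apply w hE, ← setLIntegral_const,
      ← lintegral_const_mul' _ _ h.ne]
    exact lintegral_mono_ae hae
  rw [← ENNReal.mul_div_right_comm, ENNReal.le_div_iff_mul_le (Or.inl hτ') (Or.inl ENNReal.ofReal_ne_top)]
  calc weightMeasure w B * ENNReal.ofReal τ
      = weightMeasure w B / volume B * (ENNReal.ofReal τ * volume B) := by
        rw [mul_comm (ENNReal.ofReal τ), ← mul_assoc, ENNReal.div_mul_cancel hV0 hVt]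
    _ ≤ weightMeasure w B / volume B * volume E := by gcongr
    _ ≤ _ := hint

/-- Hölder's inequality for `1 = w^{1/q} w^{-1/q}`. Finiteness of the dual integral makes `w`
positive almost everywhere on `E`, so this factorization is legitimate. -/
lemma volume_rpow_le_weightMeasure_mul {w : (Fin n → ℝ) → ℝ≥0} (hw : AEMeasurable w volume)
    {q : ℝ} (hq : 1 < q) {E : Set (Fin n → ℝ)} (hE : MeasurableSet E)
    (hσ : ∫⁻ x in E, (w x : ℝ≥0∞) ^ (-1 / (q - 1)) ≠ ∞) :
    volume E ^ q ≤ weightMeasure w E * (∫⁻ x in E, (w x : ℝ≥0∞) ^ (-1 / (q - 1))) ^ (q - 1) := by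
  have hq0 : 0 < q := by linarith
  have hq1 : 0 < q - 1 := by linarith
  have hwm : AEMeasurable (fun x => (w x : ℝ≥0∞)) (volume.restrict E) :=
    hw.restrict.coe_nnreal_ennreal
  have hpos : ∀ᵐ x ∂volume.restrict E, (w x : ℝ≥0∞) ≠ 0 := by
    filter_upwards [ae_lt_top' (hwm.pow_const _) hσ] with x hx h0
    rw [h0, ENNReal.zero_rpow_of_neg (div_neg_of_neg_of_pos (by norm_num) hq1)] at hx
    exact lt_irrefl _ hx
  have hconj : q.HolderConjugate (q / (q - 1)) := Real.HolderConjugate.conjExponent hq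
  have hH := ENNReal.lintegral_mul_le_Lp_mul_Lq (volume.restrict E) hconj
    (hwm.pow_const (1 / q)) (hwm.pow_const (-1 / q))
  have e1 : ∫⁻ x in E, ((fun x => (w x : ℝ≥0∞) ^ (1 / q)) * fun x => (w x : ℝ≥0∞) ^ (-1 / q)) x
      = volume E := by
    rw [← setLIntegral_one]
    refine lintegral_congr_ae ?_
    filter_upwards [hpos] with x hx
    rw [Pi.mul_apply, ← ENNReal.rpow_add _ _ hx ENNReal.coe_ne_top]
    ring_nf; simp
  have e2 : ∀ x, ((w x : ℝ≥0∞) ^ (1 / q)) ^ q = w x := fun x => by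
    rw [← ENNReal.rpow_mul, one_div_mul_cancel hq0.ne', ENNReal.rpow_one]
  have e3 : ∀ x, ((w x : ℝ≥0∞) ^ (-1 / q)) ^ (q / (q - 1)) = (w x : ℝ≥0∞) ^ (-1 / (q - 1)) :=
    fun x => by
      rw [← ENNReal.rpow_mul]
      congr 1
      field_simp
  simp only [e1, e2, e3] at hH
  rw [weightMeasure_apply w hE]
  calc volume E ^ q ≤ _ := ENNReal.rpow_le_rpow hH hq0.le
    _ = _ := by
      rw [ENNReal.mul_rpow_of_nonneg _ _ hq0.le, ← ENNReal.rpow_mul, ← ENNReal.rpow_mul,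
        one_div_mul_cancel hq0.ne', ENNReal.rpow_one]
      congr 2
      field_simp

lemma ApConst.subsetBound {w : (Fin n → ℝ) → ℝ≥0} (hw : AEMeasurable w volume)
    {q : ℝ} (hq : 1 < q) (h : ApConst q w < ∞) {τ : ℝ} (hτ : 0 < τ) :
    ∃ K, SubsetBound τ K (weightMeasure w) := by
  have hq0 : 0 < q := by linarith
  have hq1 : 0 < q - 1 := by linarith
  have hτ' : ENNReal.ofReal τ ^ q ≠ 0 := by simp [hq0, hτ]
  have hτt : ENNReal.ofReal τ ^ q ≠ ∞ := ENNReal.rpow_ne_top_of_nonneg hq0.le ENNReal.ofReal_ne_top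
  refine ⟨(ApConst q w / ENNReal.ofReal τ ^ q).toNNReal, fun c r hr E hE hEB hle => ?_⟩
  rw [ENNReal.coe_toNNReal (ENNReal.div_ne_top h.ne hτ')]
  set B := closedBall c r with hB
  have hV0 : volume B ≠ 0 := volume_closedBall_pos _ hr
  have hVt : volume B ≠ ∞ := volume_closedBall_ne_top _ _
  set σ := ∫⁻ x in B, (w x : ℝ≥0∞) ^ (-1 / (q - 1)) with hσdef
  have hA : weightMeasure w B / volume B * (σ / volume B) ^ (q - 1) ≤ ApConst q w :=
    le_iSup₂_of_le B (isCube_closedBall c hr) le_rfl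
  -- If the dual integral diverges, a finite `A_q` constant forces `w(B) = 0`.
  by_cases hσ : σ = ∞
  · have hwB : weightMeasure w B = 0 := by
      by_contra h0
      rw [hσ, ENNReal.top_div_of_ne_top hVt, ENNReal.top_rpow_of_pos hq1,
        ENNReal.mul_top (ENNReal.div_ne_zero.2 ⟨h0, hVt⟩)] at hA
      exact absurd h (not_lt.2 hA)
    simp [hwB]
  have hA' : weightMeasure w B * σ ^ (q - 1) ≤ ApConst q w * volume B ^ q := by
    have e : weightMeasure w B / volume B * (σ / volume B) ^ (q - 1)
        = weightMeasure w B * σ ^ (q - 1) / volume B ^ q := by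
      have : volume B ^ q = volume B * volume B ^ (q - 1) := by
        nth_rewrite 2 [← ENNReal.rpow_one (volume B)]
        rw [← ENNReal.rpow_add _ _ hV0 hVt]; congr 1; ring
      rw [ENNReal.div_rpow_of_nonneg _ _ hq1.le, this, div_eq_mul_inv, div_eq_mul_inv,
        div_eq_mul_inv, ENNReal.mul_inv (Or.inl hV0) (Or.inl hVt)]
      ring
    rw [e] at hA
    exact (ENNReal.div_le_iff_le_mul (Or.inr h.ne)
      (Or.inl (ENNReal.rpow_ne_top_of_nonneg hq0.le hVt))).1 hA
  have hσE : ∫⁻ x in E, (w x : ℝ≥0∞) ^ (-1 / (q - 1)) ≤ σ := lintegral_mono_set hEB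
  have hEq := volume_rpow_le_weightMeasure_mul hw hq hE (ne_top_of_le_ne_top hσ hσE)
  have hVq0 : volume B ^ q ≠ 0 := by simp [hV0, hVt]
  have hVqt : volume B ^ q ≠ ∞ := ENNReal.rpow_ne_top_of_nonneg hq0.le hVt
  rw [← ENNReal.mul_div_right_comm, ENNReal.le_div_iff_mul_le (Or.inl hτ') (Or.inl hτt)]
  refine (ENNReal.mul_le_mul_iff_left hVq0 hVqt).1 ?_
  calc weightMeasure w B * ENNReal.ofReal τ ^ q * volume B ^ q
      = weightMeasure w B * (ENNReal.ofReal τ * volume B) ^ q := by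
        rw [ENNReal.mul_rpow_of_nonneg _ _ hq0.le, mul_assoc]
    _ ≤ weightMeasure w B * volume E ^ q := by gcongr
    _ ≤ weightMeasure w B * (weightMeasure w E * σ ^ (q - 1)) := by
        gcongr
        exact hEq.trans (by gcongr)
    _ = (weightMeasure w B * σ ^ (q - 1)) * weightMeasure w E := by ring
    _ ≤ (ApConst q w * volume B ^ q) * weightMeasure w E := by gcongr
    _ = _ := by ring

lemma IsAInfty.subsetBound {w : (Fin n → ℝ) → ℝ≥0} (hw : AEMeasurable w volume)
    (h : IsAInfty w) {τ : ℝ} (hτ : 0 < τ) : ∃ K, SubsetBound τ K (weightMeasure w) := by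
  obtain ⟨q, ⟨-, h⟩ | ⟨hq, h⟩⟩ := h
  · exact A1Const.subsetBound h hτ
  · exact ApConst.subsetBound hw hq h hτ

/-! ### Weak-type estimate, measurability and strong-type bound -/

lemma SubsetBound.measure_closedBall_five_mul_le {D : ℝ≥0} {μ : Measure (Fin n → ℝ)}
    (hμ : SubsetBound (1 / 5 ^ n) D μ) (c : Fin n → ℝ) {r : ℝ} (hr : 0 < r) :
    μ (closedBall c (5 * r)) ≤ D * μ (closedBall c r) := by
  refine hμ c (5 * r) (by positivity) _ measurableSet_closedBall
    (closedBall_subset_closedBall (by linarith)) ?_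
  rw [volume_closedBall_mul c c (by norm_num) hr.le, ← mul_assoc, ← ENNReal.ofReal_mul (by positivity),
    one_div_mul_cancel (by positivity), ENNReal.ofReal_one, one_mul]

/-- The restricted weak type estimate for the cubes in which `E` has density at least `τ`. -/
lemma SubsetBound.measure_dense_le {τ : ℝ} {K D : ℝ≥0} {μ : Measure (Fin n → ℝ)}
    (hμ : SubsetBound τ K μ) (hD : SubsetBound (1 / 5 ^ n) D μ)
    {E : Set (Fin n → ℝ)} (hE : MeasurableSet E) :
    μ {x | ∃ (c : Fin n → ℝ) (r : ℝ), 0 < r ∧ x ∈ closedBall c r ∧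
      ENNReal.ofReal τ * volume (closedBall c r) ≤ volume (E ∩ closedBall c r)} ≤ D * K * μ E := by
  -- Vitali's lemma needs bounded radii; the bound `N` is removed by monotone continuity of the
  -- measure, which needs no measurability of the unions.
  set t : ℕ → Set ((Fin n → ℝ) × ℝ) := fun N => {a | (0 < a.2 ∧ a.2 ≤ N) ∧
    ENNReal.ofReal τ * volume (closedBall a.1 a.2) ≤ volume (E ∩ closedBall a.1 a.2)} with ht
  have htm : Monotone t := fun N M hNM a ha =>
    ⟨⟨ha.1.1, ha.1.2.trans (by exact_mod_cast hNM)⟩, ha.2⟩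
  have hsub : {x | ∃ (c : Fin n → ℝ) (r : ℝ), 0 < r ∧ x ∈ closedBall c r ∧
      ENNReal.ofReal τ * volume (closedBall c r) ≤ volume (E ∩ closedBall c r)} ⊆
      ⋃ N, ⋃ a ∈ t N, closedBall a.1 a.2 := by
    rintro x ⟨c, r, hr, hx, h⟩
    obtain ⟨N, hN⟩ := exists_nat_ge r
    exact Set.mem_iUnion.2 ⟨N, Set.mem_biUnion (x := (c, r)) ⟨⟨hr, hN⟩, h⟩ hx⟩
  refine (measure_mono hsub).trans ?_
  rw [Monotone.measure_iUnion fun N M hNM => Set.biUnion_subset_biUnion_left (htm hNM)]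
  refine iSup_le fun N => ?_
  obtain ⟨u, hut, hu, hd, hc⟩ := exists_vitali_subfamily (t N) (fun a ha => ha.1)
  calc μ (⋃ a ∈ t N, closedBall a.1 a.2)
      ≤ μ (⋃ a ∈ u, closedBall a.1 (5 * a.2)) := measure_mono hc
    _ ≤ ∑' a : u, μ (closedBall a.1.1 (5 * a.1.2)) := measure_biUnion_le _ hu _
    _ ≤ ∑' a : u, D * (K * μ (E ∩ closedBall a.1.1 a.1.2)) := ENNReal.tsum_le_tsum fun a =>
        (hD.measure_closedBall_five_mul_le _ (hut a.2).1.1).trans <| by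
          gcongr
          exact hμ _ _ (hut a.2).1.1 _ (hE.inter measurableSet_closedBall) Set.inter_subset_right
            (hut a.2).2
    _ = D * (K * μ (⋃ a ∈ u, E ∩ closedBall a.1 a.2)) := by
        rw [ENNReal.tsum_mul_left, ENNReal.tsum_mul_left, measure_biUnion hu
          (hd.mono fun _ => Set.inter_subset_right) fun _ _ => hE.inter measurableSet_closedBall]
    _ ≤ D * (K * μ E) := by
        gcongr
        exact Set.iUnion₂_subset fun _ _ => Set.inter_subset_left
    _ = _ := by ring

/-- An arbitrary union of cubes is Lebesgue measurable. -/
lemma nullMeasurableSet_biUnion_closedBall (t : Set ((Fin n → ℝ) × ℝ)) (ht : ∀ a ∈ t, 0 < a.2) :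
    NullMeasurableSet (⋃ a ∈ t, closedBall a.1 a.2) (volume : Measure (Fin n → ℝ)) := by
  set O : Set (Fin n → ℝ) := ⋃ a ∈ t, ball a.1 a.2 with hO
  have hOm : MeasurableSet O := (isOpen_biUnion fun _ _ => isOpen_ball).measurableSet
  -- The union differs from the open set `O` by a null set: at almost every point of `Oᶜ` the
  -- density of `Oᶜ` is 1, but in a cube of the family containing it the homothetic copies have
  -- interiors in `O`, giving density 0.
  refine hOm.nullMeasurableSet.congr ?_
  have hsub : O ⊆ ⋃ a ∈ t, closedBall a.1 a.2 :=
    Set.iUnion₂_mono fun _ _ => ball_subset_closedBall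
  refine hsub.eventuallyLE.antisymm ?_
  filter_upwards [(ae_restrict_iff' hOm.compl).1
    (ae_tendsto_density_homothety Oᶜ (ρ := 1 / 2) (by norm_num) (by norm_num))] with x hx hxU
  by_contra hxO
  obtain ⟨⟨c, r⟩, ha, hxc⟩ := Set.mem_iUnion₂.1 hxU
  have hr : 0 < r := ht _ ha
  have hlim := hx hxO c r hr hxc
  have hzero : ∀ k : ℕ, volume (Oᶜ ∩ closedBall (AffineMap.lineMap x c ((1 / 2 : ℝ) ^ k))
      ((1 / 2 : ℝ) ^ k * r)) = 0 := by
    intro k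
    have hk : 0 < (1 / 2 : ℝ) ^ k * r := by positivity
    refine measure_mono_null (t := sphere (AffineMap.lineMap x c ((1 / 2 : ℝ) ^ k))
      ((1 / 2 : ℝ) ^ k * r)) ?_ (Measure.addHaar_sphere_of_ne_zero volume _ hk.ne')
    rintro y ⟨hyO, hy⟩
    by_contra hys
    have hyb : y ∈ ball (AffineMap.lineMap x c ((1 / 2 : ℝ) ^ k)) ((1 / 2 : ℝ) ^ k * r) :=
      mem_ball.2 (lt_of_le_of_ne (mem_closedBall.1 hy) hys)
    refine hyO (Set.mem_biUnion ha ?_)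
    have hs : ball (AffineMap.lineMap x c ((1 / 2 : ℝ) ^ k)) ((1 / 2 : ℝ) ^ k * r) ⊆ ball c r := by
      have := closedBall_lineMap_subset hxc
        (pow_le_one₀ (n := k) (by norm_num : (0 : ℝ) ≤ 1 / 2) (by norm_num))
      simp only [AffineMap.lineMap_apply_one, one_mul] at this
      rw [← interior_closedBall c hr.ne', ← interior_closedBall _ hk.ne']
      exact interior_mono this
    exact hs hyb
  simp only [hzero, ENNReal.zero_div] at hlim
  exact zero_ne_one (tendsto_nhds_unique tendsto_const_nhds hlim)

lemma lt_levelMaximal_iff {τ : ℝ} {f : (Fin n → ℝ) → ℝ} {x : Fin n → ℝ} {a : ℝ≥0∞} :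
    a < levelMaximal τ f x ↔
      ∃ c r, 0 < r ∧ x ∈ closedBall c r ∧ a < level τ f (closedBall c r) := by
  simp only [levelMaximal, lt_iSup_iff]
  constructor
  · rintro ⟨Q, hQ, hx, h⟩
    obtain ⟨c, r, hr, rfl⟩ := isCube_iff.1 hQ
    exact ⟨c, r, hr, hx, h⟩
  · rintro ⟨c, r, hr, hx, h⟩
    exact ⟨_, isCube_closedBall c hr, hx, h⟩

/-- Strict superlevel sets are unions of cubes, hence Lebesgue measurable. -/
lemma aemeasurable_levelMaximal (τ : ℝ) (f : (Fin n → ℝ) → ℝ) :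
    AEMeasurable (levelMaximal τ f) volume := by
  refine NullMeasurable.aemeasurable ?_
  refine measurable_of_Ioi (δ := NullMeasurableSpace (Fin n → ℝ) volume) fun a => ?_
  have : levelMaximal τ f ⁻¹' Set.Ioi a = ⋃ b ∈ {b : (Fin n → ℝ) × ℝ |
      0 < b.2 ∧ a < level τ f (closedBall b.1 b.2)}, closedBall b.1 b.2 := by
    ext x
    simp only [Set.mem_preimage, Set.mem_Ioi, lt_levelMaximal_iff, Set.mem_iUnion, Prod.exists,
      Set.mem_ofPred_eq, exists_prop]
    exact ⟨fun ⟨c, r, h1, h2, h3⟩ => ⟨c, r, ⟨h1, h3⟩, h2⟩,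
      fun ⟨c, r, ⟨h1, h3⟩, h2⟩ => ⟨c, r, h1, h2, h3⟩⟩
  change NullMeasurableSet (levelMaximal τ f ⁻¹' Set.Ioi a) volume
  rw [this]
  exact nullMeasurableSet_biUnion_closedBall _ fun b hb => hb.1

lemma level_congr {τ : ℝ} {f g : (Fin n → ℝ) → ℝ} (h : f =ᵐ[volume] g) (Q : Set (Fin n → ℝ)) :
    level τ f Q = level τ g Q := by
  have : ∀ α : ℝ≥0, volume (Q ∩ {x | (α : ℝ) ≤ |f x|}) = volume (Q ∩ {x | (α : ℝ) ≤ |g x|}) :=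
    fun α => measure_congr <| by
      filter_upwards [h] with x hx
      refine propext (and_congr Iff.rfl ?_)
      change (α : ℝ) ≤ |f x| ↔ (α : ℝ) ≤ |g x|
      rw [hx]
  simp only [level, this]

lemma levelMaximal_congr {τ : ℝ} {f g : (Fin n → ℝ) → ℝ} (h : f =ᵐ[volume] g) :
    levelMaximal τ f = levelMaximal τ g := by
  funext x
  simp only [levelMaximal, level_congr h]

lemma exists_dense_of_lt_levelMaximal {τ : ℝ} {f : (Fin n → ℝ) → ℝ} {x : Fin n → ℝ} {a : ℝ≥0∞}
    (h : a < levelMaximal τ f x) :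
    ∃ (c : Fin n → ℝ) (r : ℝ), 0 < r ∧ x ∈ closedBall c r ∧ ENNReal.ofReal τ *
      volume (closedBall c r) ≤ volume ({x | a < ‖f x‖ₑ} ∩ closedBall c r) := by
  obtain ⟨c, r, hr, hx, h⟩ := lt_levelMaximal_iff.1 h
  refine ⟨c, r, hr, hx, ?_⟩
  simp only [level, lt_iSup_iff] at h
  obtain ⟨α, hα, haα⟩ := h
  rw [ENNReal.le_div_iff_mul_le (Or.inl (volume_closedBall_pos _ hr))
    (Or.inl (volume_closedBall_ne_top _ _))] at hα
  refine hα.trans (measure_mono fun y hy => ⟨haα.trans_le ?_, hy.1⟩)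
  have : (α : ℝ) ≤ ‖f y‖ := hy.2
  rw [← ofReal_norm]
  simpa using ENNReal.ofReal_le_ofReal this

/-- Comparison of distribution functions passes to integrals of powers. -/
lemma lintegral_rpow_le_of_distribution {α : Type*} [MeasurableSpace α] {μ : Measure α}
    {f : α → ℝ} {g : α → ℝ≥0∞} (hf : AEMeasurable f μ) (hg : AEMeasurable g μ) {p : ℝ} (hp : 0 < p)
    {K : ℝ≥0} (h : ∀ a : ℝ≥0∞, μ {x | a < g x} ≤ K * μ {x | a < ‖f x‖ₑ})
    (hfin : ∫⁻ x, ‖f x‖ₑ ^ p ∂μ ≠ ∞) :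
    ∫⁻ x, g x ^ p ∂μ ≤ K * ∫⁻ x, ‖f x‖ₑ ^ p ∂μ := by
  -- The layer-cake formula is applied to real-valued functions, so `g = ∞` must first be excluded
  -- almost everywhere; Chebyshev's inequality for `f` does this.
  have hgfin : ∀ᵐ x ∂μ, g x ≠ ∞ := by
    rw [ae_iff]
    simp only [not_not]
    have hN : ∀ N : ℕ, μ {x | g x = ∞} ≤ K * ((∫⁻ x, ‖f x‖ₑ ^ p ∂μ) / ((N : ℝ≥0∞) + 1) ^ p) := by
      intro N
      have hN0 : ((N : ℝ≥0∞) + 1) ^ p ≠ 0 := by simp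
      have hNt : ((N : ℝ≥0∞) + 1) ^ p ≠ ∞ := ENNReal.rpow_ne_top_of_nonneg hp.le (by simp)
      calc μ {x | g x = ∞} ≤ μ {x | (N : ℝ≥0∞) + 1 < g x} := measure_mono fun x hx => by
            have hx : g x = ∞ := hx
            simp [hx, lt_top_iff_ne_top]
        _ ≤ K * μ {x | (N : ℝ≥0∞) + 1 < ‖f x‖ₑ} := h _
        _ ≤ K * μ {x | ((N : ℝ≥0∞) + 1) ^ p ≤ ‖f x‖ₑ ^ p} := by
            gcongr with x
            intro hx
            exact ENNReal.rpow_le_rpow hx.le hp.le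
        _ ≤ _ := by
            gcongr
            exact meas_ge_le_lintegral_div (hf.enorm.pow_const p) hN0 hNt
    have hlim : Tendsto (fun N : ℕ => K * ((∫⁻ x, ‖f x‖ₑ ^ p ∂μ) / ((N : ℝ≥0∞) + 1) ^ p)) atTop
        (𝓝 (K * 0)) := by
      refine ENNReal.Tendsto.const_mul ?_ (Or.inr ENNReal.coe_ne_top)
      rw [← ENNReal.div_top (a := ∫⁻ x, ‖f x‖ₑ ^ p ∂μ)]
      refine ENNReal.Tendsto.const_div ?_ (Or.inr hfin)
      have h1 : Tendsto (fun N : ℕ => (N : ℝ≥0∞) + 1) atTop (𝓝 ∞) := by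
        exact_mod_cast ENNReal.tendsto_nat_nhds_top.comp (tendsto_add_atTop_nat 1)
      have h2 := (ENNReal.continuous_rpow_const (y := p)).tendsto ∞
      rw [ENNReal.top_rpow_of_pos hp] at h2
      exact h2.comp h1
    rw [mul_zero] at hlim
    exact le_antisymm (ge_of_tendsto' hlim hN) (zero_le)
  have e1 : ∫⁻ x, g x ^ p ∂μ = ∫⁻ x, ENNReal.ofReal ((g x).toReal ^ p) ∂μ := by
    refine lintegral_congr_ae ?_
    filter_upwards [hgfin] with x hx
    rw [← ENNReal.ofReal_rpow_of_nonneg ENNReal.toReal_nonneg hp.le, ENNReal.ofReal_toReal hx]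
  have e2 : ∫⁻ x, ‖f x‖ₑ ^ p ∂μ = ∫⁻ x, ENNReal.ofReal (|f x| ^ p) ∂μ := by
    refine lintegral_congr fun x => ?_
    rw [← ENNReal.ofReal_rpow_of_nonneg (abs_nonneg _) hp.le, ← Real.norm_eq_abs,
      ofReal_norm]
  rw [e1, e2, lintegral_rpow_eq_lintegral_meas_lt_mul μ
      (Eventually.of_forall fun x => ENNReal.toReal_nonneg) hg.ennreal_toReal hp,
    lintegral_rpow_eq_lintegral_meas_lt_mul μ
      (Eventually.of_forall fun x => abs_nonneg _) hf.abs hp, mul_left_comm,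
    ← lintegral_const_mul' _ _ ENNReal.coe_ne_top]
  refine mul_le_mul' le_rfl (setLIntegral_mono' measurableSet_Ioi fun t ht => ?_)
  rw [← mul_assoc]
  gcongr
  have ht0 : (0 : ℝ) < t := ht
  calc μ {x | t < (g x).toReal} ≤ μ {x | ENNReal.ofReal t < g x} := by
        refine measure_mono fun x hx => ?_
        have hx : t < (g x).toReal := hx
        have hgx : g x ≠ ∞ := fun h => by rw [h, ENNReal.toReal_top] at hx; linarith
        exact (ENNReal.ofReal_lt_iff_lt_toReal ht0.le hgx).2 hx
    _ ≤ _ := h _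
    _ ≤ K * μ {x | t < |f x|} := by
      gcongr with x
      intro hx
      rw [← ofReal_norm, ENNReal.ofReal_lt_ofReal_iff_of_nonneg ht0.le] at hx
      exact hx

theorem IsAInfty.boundedOnLp {w : (Fin n → ℝ) → ℝ≥0} (hw : AEMeasurable w volume)
    (h : IsAInfty w) {τ p : ℝ} (hτ : 0 < τ) (hp : 0 < p) : BoundedOnLp τ p w := by
  obtain ⟨K, hK⟩ := h.subsetBound hw hτ
  obtain ⟨D, hD⟩ := h.subsetBound hw (τ := 1 / 5 ^ n) (by positivity)
  refine ⟨(D * K) ^ (1 / p), fun f hf hfin => ?_⟩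
  have hac := weightMeasure_absolutelyContinuous w
  have hp0 : ENNReal.ofReal p ≠ 0 := by simpa using hp
  have hM : AEMeasurable (levelMaximal τ f) (weightMeasure w) :=
    (aemeasurable_levelMaximal τ f).mono_ac hac
  have key : eLpNorm (levelMaximal τ f) (ENNReal.ofReal p) (weightMeasure w)
      ≤ ((D * K) ^ (1 / p) : ℝ≥0) * eLpNorm f (ENNReal.ofReal p) (weightMeasure w) := by
    -- Passing to a Borel version of `f` leaves the maximal function unchanged at every point.
    have hff : f =ᵐ[volume] hf.mk f := hf.ae_eq_mk
    rw [eLpNorm_congr_ae (hac.ae_eq hff)] at hfin ⊢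
    rw [levelMaximal_congr hff] at hM ⊢
    set g := hf.mk f
    have hg : Measurable g := hf.measurable_mk
    rw [eLpNorm_eq_lintegral_rpow_enorm_toReal hp0 ENNReal.ofReal_ne_top,
      ENNReal.toReal_ofReal hp.le] at hfin
    rw [eLpNorm_eq_lintegral_rpow_enorm_toReal hp0 ENNReal.ofReal_ne_top,
      eLpNorm_eq_lintegral_rpow_enorm_toReal hp0 ENNReal.ofReal_ne_top, ENNReal.toReal_ofReal hp.le,
      ENNReal.coe_rpow_of_nonneg _ (by positivity), ← ENNReal.mul_rpow_of_nonneg _ _ (by positivity)]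
    refine ENNReal.rpow_le_rpow ?_ (by positivity)
    simp only [enorm_eq_self]
    refine lintegral_rpow_le_of_distribution hg.aemeasurable hM hp (fun a => ?_) ?_
    · refine (measure_mono fun x hx => ?_).trans
        ((hK.measure_dense_le hD (E := {x | a < ‖g x‖ₑ}) (measurableSet_lt measurable_const hg.enorm)).trans ?_)
      · exact exists_dense_of_lt_levelMaximal hx
      · push_cast; exact le_rfl
    · intro htop
      rw [htop, ENNReal.top_rpow_of_pos (by positivity)] at hfin
      exact lt_irrefl _ hfin
  exact ⟨⟨hM.aestronglyMeasurable, key.trans_lt (ENNReal.mul_lt_top ENNReal.coe_lt_top hfin)⟩, key⟩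

/-! ### From boundedness to the subset bound -/

lemma one_le_levelMaximal_indicator {τ : ℝ} {c : Fin n → ℝ} {r : ℝ} (hr : 0 < r)
    {E : Set (Fin n → ℝ)} (hEB : E ⊆ closedBall c r)
    (hle : ENNReal.ofReal τ * volume (closedBall c r) ≤ volume E)
    {x : Fin n → ℝ} (hx : x ∈ closedBall c r) :
    1 ≤ levelMaximal τ (E.indicator fun _ => (1 : ℝ)) x := by
  classical
  refine le_iSup₂_of_le (closedBall c r) (isCube_closedBall c hr) (le_iSup_of_le hx ?_)
  refine le_iSup₂_of_le (1 : ℝ≥0) ?_ (by simp)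
  rw [ENNReal.le_div_iff_mul_le (Or.inl (volume_closedBall_pos _ hr))
    (Or.inl (volume_closedBall_ne_top _ _))]
  refine hle.trans (measure_mono fun y hy => ⟨hEB hy, ?_⟩)
  simp [hy]

lemma BoundedOnLp.subsetBound {τ p : ℝ} (hp : 0 < p) {w : (Fin n → ℝ) → ℝ≥0}
    (h : BoundedOnLp τ p w) : ∃ K, SubsetBound τ K (weightMeasure w) := by
  obtain ⟨C, hC⟩ := h
  -- The summand 1 keeps the constant nonzero, so that the bound is trivial when `w(E) = ∞`.
  refine ⟨C ^ p + 1, fun c r hr E hE hEB hle => ?_⟩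
  have hp0 : ENNReal.ofReal p ≠ 0 := by simpa using hp
  by_cases hEt : weightMeasure w E = ∞
  · rw [hEt, ENNReal.mul_top (by simp)]; exact le_top
  have hf : eLpNorm (E.indicator fun _ => (1 : ℝ)) (ENNReal.ofReal p) (weightMeasure w)
      = weightMeasure w E ^ (1 / p) := by
    rw [eLpNorm_indicator_const hE hp0 ENNReal.ofReal_ne_top, ENNReal.toReal_ofReal hp.le]
    simp
  have hB : eLpNorm ((closedBall c r).indicator fun _ => (1 : ℝ≥0∞)) (ENNReal.ofReal p)
      (weightMeasure w) = weightMeasure w (closedBall c r) ^ (1 / p) := by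
    rw [eLpNorm_indicator_const measurableSet_closedBall hp0 ENNReal.ofReal_ne_top,
      ENNReal.toReal_ofReal hp.le]
    simp
  have hmono : weightMeasure w (closedBall c r) ^ (1 / p) ≤ C * weightMeasure w E ^ (1 / p) := by
    rw [← hf, ← hB]
    refine le_trans (eLpNorm_mono_enorm fun x => ?_) (hC _ ?_ ?_).2
    · by_cases hx : x ∈ closedBall c r
      · simpa [hx] using one_le_levelMaximal_indicator hr hEB hle hx
      · simp [hx]
    · exact (measurable_const.indicator hE).aemeasurable
    · rw [hf]
      exact ENNReal.rpow_lt_top_of_nonneg (by positivity) hEt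
  have := ENNReal.rpow_le_rpow hmono hp.le
  rw [ENNReal.mul_rpow_of_nonneg _ _ hp.le, ← ENNReal.rpow_mul, ← ENNReal.rpow_mul,
    one_div_mul_cancel hp.ne', ENNReal.rpow_one, ENNReal.rpow_one] at this
  refine this.trans ?_
  rw [← ENNReal.coe_rpow_of_nonneg _ hp.le]
  gcongr
  simp

/-! ### From the subset bound to `A_∞` -/

/-- The truncations `{w ≤ N}` exhaust the cube, so one of them has density above `τ < 1`; its weight
is at most `N` times the volume of the cube. -/
lemma SubsetBound.weightMeasure_closedBall_ne_top {τ : ℝ} (hτ1 : τ < 1) {K : ℝ≥0}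
    {w : (Fin n → ℝ) → ℝ≥0} (hw : Measurable w) (h : SubsetBound τ K (weightMeasure w))
    (c : Fin n → ℝ) {r : ℝ} (hr : 0 < r) : weightMeasure w (closedBall c r) ≠ ∞ := by
  set E : ℕ → Set (Fin n → ℝ) := fun N => closedBall c r ∩ {x | w x ≤ N} with hE
  have hEm : ∀ N, MeasurableSet (E N) := fun N =>
    measurableSet_closedBall.inter (measurableSet_le hw measurable_const)
  have hmono : Monotone E := fun N M hNM x hx =>
    ⟨hx.1, le_trans (show w x ≤ N from hx.2) (by exact_mod_cast hNM)⟩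
  have hU : ⋃ N, E N = closedBall c r := by
    refine Set.Subset.antisymm (Set.iUnion_subset fun N => Set.inter_subset_left) fun x hx => ?_
    obtain ⟨N, hN⟩ := exists_nat_ge (w x)
    exact Set.mem_iUnion.2 ⟨N, hx, hN⟩
  have hlim := tendsto_measure_iUnion_atTop (μ := volume) hmono
  rw [hU] at hlim
  have hlt : ENNReal.ofReal τ * volume (closedBall c r) < volume (closedBall c r) := by
    conv_rhs => rw [← one_mul (volume (closedBall c r))]
    exact (ENNReal.mul_lt_mul_iff_left (volume_closedBall_pos _ hr)
      (volume_closedBall_ne_top _ _)).2 (by simpa using hτ1)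
  obtain ⟨N, hN⟩ := (hlim.eventually_const_lt hlt).exists
  refine ne_top_of_le_ne_top (ENNReal.mul_ne_top ENNReal.coe_ne_top ?_)
    (h c r hr (E N) (hEm N) Set.inter_subset_left hN.le)
  have : weightMeasure w (E N) ≤ (N : ℝ≥0∞) * volume (closedBall c r) := by
    rw [weightMeasure_apply w (hEm N)]
    calc ∫⁻ x in E N, (w x : ℝ≥0∞) ≤ ∫⁻ _ in E N, (N : ℝ≥0∞) :=
          setLIntegral_mono' (hEm N) fun x hx => by
            have : w x ≤ N := hx.2
            exact_mod_cast this
      _ = N * volume (E N) := setLIntegral_const _ _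
      _ ≤ _ := by gcongr; exact Set.inter_subset_left
  exact ne_top_of_le_ne_top
    (ENNReal.mul_ne_top (ENNReal.natCast_ne_top N) (volume_closedBall_ne_top _ _)) this

/-- Geometric decay of the sublevel sets of the weight. -/
lemma volume_sublevel_le {τ s : ℝ} (hs : 0 < s) {K : ℝ≥0} {k : ℕ} {w : (Fin n → ℝ) → ℝ≥0}
    (hw : Measurable w) (h : SubsetBound (τ / s ^ k) (K * (1 + K) ^ k) (weightMeasure w))
    (hτ1 : τ < 1) {c : Fin n → ℝ} {r : ℝ} (hr : 0 < r)
    (h0 : weightMeasure w (closedBall c r) ≠ 0) (ht : weightMeasure w (closedBall c r) ≠ ∞) :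
    volume (closedBall c r ∩ {x | (w x : ℝ≥0∞) ≤ (((2 + K : ℝ≥0) : ℝ≥0∞)⁻¹) ^ (k + 1) *
      (weightMeasure w (closedBall c r) / volume (closedBall c r))}) ≤
      (ENNReal.ofReal s)⁻¹ ^ k * volume (closedBall c r) := by
  set B := closedBall c r with hB
  have hV0 : volume B ≠ 0 := volume_closedBall_pos _ hr
  have hVt : volume B ≠ ∞ := volume_closedBall_ne_top _ _
  set a : ℝ≥0∞ := ((2 + K : ℝ≥0) : ℝ≥0∞)⁻¹ ^ (k + 1) with ha
  set E := B ∩ {x | (w x : ℝ≥0∞) ≤ a * (weightMeasure w B / volume B)} with hE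
  have hEm : MeasurableSet E :=
    measurableSet_closedBall.inter (measurableSet_le hw.coe_nnreal_ennreal measurable_const)
  have hτs : ENNReal.ofReal (τ / s ^ k) ≤ (ENNReal.ofReal s)⁻¹ ^ k := by
    rw [← ENNReal.ofReal_inv_of_pos hs, ← ENNReal.ofReal_pow (by positivity)]
    refine ENNReal.ofReal_le_ofReal ?_
    rw [div_eq_mul_inv, inv_pow]
    exact mul_le_of_le_one_left (by positivity) hτ1.le
  refine le_trans ?_ (mul_le_mul_left hτs (volume B))
  by_contra hcon
  have h1 := h c r hr E hEm Set.inter_subset_left (not_le.1 hcon).le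
  have h2 : weightMeasure w E ≤ a * weightMeasure w B := by
    rw [weightMeasure_apply w hEm]
    calc ∫⁻ x in E, (w x : ℝ≥0∞) ≤ ∫⁻ _ in E, a * (weightMeasure w B / volume B) :=
          setLIntegral_mono' hEm fun x hx => hx.2
      _ = a * (weightMeasure w B / volume B) * volume E := setLIntegral_const _ _
      _ ≤ a * (weightMeasure w B / volume B) * volume B := by
          gcongr; exact Set.inter_subset_left
      _ = _ := by rw [mul_assoc, ENNReal.div_mul_cancel hV0 hVt]
  -- The base `2 + K` makes `K (1 + K)^k < (2 + K)^(k+1)`, so a sublevel set that is too large would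
  -- contradict the iterated bound.
  have h3 : ((K * (1 + K) ^ k : ℝ≥0) : ℝ≥0∞) * a < 1 := by
    rw [ha, ← ENNReal.coe_inv (by positivity), ← ENNReal.coe_pow, ← ENNReal.coe_mul,
      ENNReal.coe_lt_one_iff, inv_pow, ← div_eq_mul_inv, div_lt_one (by positivity), pow_succ']
    calc K * (1 + K) ^ k ≤ K * (2 + K) ^ k := by gcongr; norm_num
      _ < (2 + K) * (2 + K) ^ k := by
        gcongr
        exact lt_add_of_pos_left K two_pos
  have h4 : weightMeasure w B < weightMeasure w B := by
    calc weightMeasure w B ≤ _ := h1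
      _ ≤ ((K * (1 + K) ^ k : ℝ≥0) : ℝ≥0∞) * (a * weightMeasure w B) := by gcongr
      _ = ((K * (1 + K) ^ k : ℝ≥0) : ℝ≥0∞) * a * weightMeasure w B := by ring
      _ < 1 * weightMeasure w B := (ENNReal.mul_lt_mul_iff_left h0 ht).2 h3
      _ = _ := one_mul _
  exact lt_irrefl _ h4

/-- For `v > 0` the term at the first `k` with `b^(k+1) m < v` already dominates; the alternative `k
= 0` covers values above `m`. For `v = 0` the sum is infinite. -/
lemma rpow_neg_le_tsum {δ : ℝ} (hδ : 0 < δ) {b m : ℝ≥0∞} (hb : b < 1) (hm : m ≠ ∞) (v : ℝ≥0) :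
    (v : ℝ≥0∞) ^ (-δ) ≤
      ∑' k : ℕ, if k = 0 ∨ (v : ℝ≥0∞) ≤ b ^ k * m then (b ^ (k + 1) * m) ^ (-δ) else 0 := by
  classical
  by_cases hv : v = 0
  · subst hv
    by_cases hm0 : m = 0
    · refine le_trans ?_ (ENNReal.le_tsum 0)
      simp [hm0]
    have hterm : ∀ k : ℕ, m ^ (-δ) ≤ if k = 0 ∨ ((0 : ℝ≥0) : ℝ≥0∞) ≤ b ^ k * m then
        (b ^ (k + 1) * m) ^ (-δ) else 0 := by
      intro k
      rw [if_pos (Or.inr (by simp))]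
      rw [ENNReal.rpow_neg, ENNReal.rpow_neg, ENNReal.inv_le_inv]
      refine ENNReal.rpow_le_rpow (mul_le_of_le_one_left' (pow_le_one₀ (zero_le) hb.le)) hδ.le
    refine le_trans ?_ (ENNReal.tsum_le_tsum hterm)
    rw [ENNReal.tsum_const_eq_top_of_ne_zero]
    · exact le_top
    · rw [ENNReal.rpow_neg]
      exact ENNReal.inv_ne_zero.2 (ENNReal.rpow_ne_top_of_nonneg hδ.le hm)
  · have hex : ∃ k : ℕ, b ^ (k + 1) * m < v := by
      have hlim : Tendsto (fun k : ℕ => b ^ (k + 1) * m) atTop (𝓝 (0 * m)) :=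
        ENNReal.Tendsto.mul_const ((ENNReal.tendsto_pow_atTop_nhds_zero_of_lt_one hb).comp
          (tendsto_add_atTop_nat 1)) (Or.inr hm)
      rw [zero_mul] at hlim
      exact (hlim.eventually_lt_const (by simpa [pos_iff_ne_zero] using hv)).exists
    refine le_trans ?_ (ENNReal.le_tsum (Nat.find hex))
    have hcond : Nat.find hex = 0 ∨ (v : ℝ≥0∞) ≤ b ^ (Nat.find hex) * m := by
      rcases Nat.eq_zero_or_eq_succ_pred (Nat.find hex) with h | h
      · exact Or.inl h
      · have := Nat.find_min hex (m := (Nat.find hex).pred) (by omega)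
        right
        rw [h]
        exact not_lt.1 this
    rw [if_pos hcond, ENNReal.rpow_neg, ENNReal.rpow_neg, ENNReal.inv_le_inv]
    exact ENNReal.rpow_le_rpow (Nat.find_spec hex).le hδ.le

/-- Integrating the layer decomposition term by term gives a geometric series of ratio `β^δ t`. -/
lemma setLIntegral_rpow_neg_le {δ : ℝ} (hδ : 0 < δ) {β : ℝ≥0} (hβ : 1 < β) {m S t : ℝ≥0∞}
    (hm : m ≠ ∞) {w : (Fin n → ℝ) → ℝ≥0} (hw : Measurable w) {B : Set (Fin n → ℝ)}
    (hdec : ∀ k : ℕ, volume (B ∩ {x | k = 0 ∨ (w x : ℝ≥0∞) ≤ (β : ℝ≥0∞)⁻¹ ^ k * m}) ≤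
      S * t ^ k * volume B) :
    ∫⁻ x in B, (w x : ℝ≥0∞) ^ (-δ) ≤
      m ^ (-δ) * ((β : ℝ≥0∞) ^ δ * S * (1 - (β : ℝ≥0∞) ^ δ * t)⁻¹) * volume B := by
  classical
  have hβ0 : (β : ℝ≥0∞) ≠ 0 := by simpa using (zero_lt_one.trans hβ).ne'
  have hA : ∀ k : ℕ, MeasurableSet {x | k = 0 ∨ (w x : ℝ≥0∞) ≤ (β : ℝ≥0∞)⁻¹ ^ k * m} := fun k =>
    (MeasurableSet.const _).union (measurableSet_le hw.coe_nnreal_ennreal measurable_const)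
  have hcoef : ∀ k : ℕ, ((β : ℝ≥0∞)⁻¹ ^ (k + 1) * m) ^ (-δ)
      = ((β : ℝ≥0∞) ^ δ) ^ (k + 1) * m ^ (-δ) := by
    intro k
    rw [ENNReal.mul_rpow_of_ne_top (ENNReal.pow_ne_top (ENNReal.inv_ne_top.2 hβ0)) hm]
    congr 1
    rw [← ENNReal.inv_pow, ENNReal.inv_rpow, ENNReal.rpow_neg, inv_inv, ← ENNReal.rpow_natCast,
      ← ENNReal.rpow_natCast, ← ENNReal.rpow_mul, ← ENNReal.rpow_mul, mul_comm]
  calc ∫⁻ x in B, (w x : ℝ≥0∞) ^ (-δ)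
      ≤ ∫⁻ x in B, ∑' k : ℕ, {x | k = 0 ∨ (w x : ℝ≥0∞) ≤ (β : ℝ≥0∞)⁻¹ ^ k * m}.indicator
          (fun _ => ((β : ℝ≥0∞)⁻¹ ^ (k + 1) * m) ^ (-δ)) x := by
        refine lintegral_mono fun x => ?_
        have := rpow_neg_le_tsum hδ (b := (β : ℝ≥0∞)⁻¹) (ENNReal.inv_lt_one.2 (by exact_mod_cast hβ))
          hm (w x)
        simpa only [Set.indicator_apply, Set.mem_ofPred_eq] using this
    _ = ∑' k : ℕ, ((β : ℝ≥0∞)⁻¹ ^ (k + 1) * m) ^ (-δ) *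
          volume (B ∩ {x | k = 0 ∨ (w x : ℝ≥0∞) ≤ (β : ℝ≥0∞)⁻¹ ^ k * m}) := by
        rw [lintegral_tsum fun k => (measurable_const.indicator (hA k)).aemeasurable]
        refine tsum_congr fun k => ?_
        rw [lintegral_indicator_const (hA k), Measure.restrict_apply (hA k), Set.inter_comm]
    _ ≤ ∑' k : ℕ, (((β : ℝ≥0∞) ^ δ) ^ (k + 1) * m ^ (-δ)) * (S * t ^ k * volume B) := by
        refine ENNReal.tsum_le_tsum fun k => ?_
        rw [hcoef]
        gcongr
        exact hdec k
    _ = ∑' k : ℕ, (m ^ (-δ) * ((β : ℝ≥0∞) ^ δ * S) * volume B) * ((β : ℝ≥0∞) ^ δ * t) ^ k := by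
        refine tsum_congr fun k => ?_
        rw [mul_pow, pow_succ]; ring
    _ = _ := by
        rw [ENNReal.tsum_mul_left, ENNReal.tsum_geometric]; ring

lemma exists_rpow_lt {b s : ℝ} (hb : 0 < b) (hs : 1 < s) : ∃ δ : ℝ, 0 < δ ∧ b ^ δ < s := by
  have hc : Tendsto (fun δ : ℝ => b ^ δ) (𝓝[>] 0) (𝓝 1) := by
    have : ContinuousAt (fun δ : ℝ => b ^ δ) 0 := (Real.continuousAt_const_rpow hb.ne')
    simpa [ContinuousAt] using this.tendsto.mono_left (nhdsWithin_le_nhds (s := Set.Ioi 0))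
  obtain ⟨δ, h, h'⟩ := ((hc.eventually_lt_const hs).and self_mem_nhdsWithin).exists
  exact ⟨δ, h', h⟩

theorem SubsetBound.isAInfty {τ : ℝ} (hτ0 : 0 < τ) (hτ1 : τ < 1) {K : ℝ≥0}
    {w : (Fin n → ℝ) → ℝ≥0} (hw : Measurable w) (h : SubsetBound τ K (weightMeasure w)) :
    IsAInfty w := by
  obtain ⟨s, hs, hiter⟩ := h.exists_iterate hτ0 hτ1
  have hs0 : 0 < s := by linarith
  set β : ℝ≥0 := 2 + K with hβ
  have hβ1 : 1 < β := lt_of_lt_of_le one_lt_two (by simp [hβ])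
  -- With `β^δ < s`, the growth of `w^{-δ}` across layers is beaten by the volume decay `s^{-k}`.
  obtain ⟨δ, hδ, hδs⟩ := exists_rpow_lt (b := β) (by positivity) hs
  set S : ℝ≥0∞ := ENNReal.ofReal s with hS
  have hS0 : S ≠ 0 := by simpa [hS] using hs0
  have hSt : S ≠ ∞ := ENNReal.ofReal_ne_top
  set G : ℝ≥0∞ := (β : ℝ≥0∞) ^ δ * S * (1 - (β : ℝ≥0∞) ^ δ * S⁻¹)⁻¹ with hG
  have hβδ : (β : ℝ≥0∞) ^ δ * S⁻¹ < 1 := by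
    rw [← div_eq_mul_inv, ENNReal.div_lt_iff (Or.inl hS0) (Or.inl hSt), one_mul, hS,
      ← ENNReal.ofReal_coe_nnreal, ENNReal.ofReal_rpow_of_nonneg (NNReal.coe_nonneg β) hδ.le]
    exact (ENNReal.ofReal_lt_ofReal_iff hs0).2 hδs
  have hGt : G ≠ ∞ := ENNReal.mul_ne_top
    (ENNReal.mul_ne_top (ENNReal.rpow_ne_top_of_nonneg hδ.le ENNReal.coe_ne_top) hSt)
    (ENNReal.inv_ne_top.2 (tsub_pos_of_lt hβδ).ne')
  refine ⟨1 + 1 / δ, Or.inr ⟨by simpa using hδ, ?_⟩⟩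
  refine lt_of_le_of_lt ?_ (ENNReal.rpow_lt_top_of_nonneg (by positivity : 0 ≤ 1 / δ) hGt)
  refine iSup₂_le fun Q hQ => ?_
  obtain ⟨c, r, hr, rfl⟩ := isCube_iff.1 hQ
  have e1 : (1 + 1 / δ - 1) = 1 / δ := by ring
  have e2 : -1 / (1 / δ) = -δ := by field_simp
  rw [e1, e2]
  set B := closedBall c r with hB
  have hV0 : volume B ≠ 0 := volume_closedBall_pos _ hr
  have hVt : volume B ≠ ∞ := volume_closedBall_ne_top _ _
  by_cases h0 : weightMeasure w B = 0
  · simp [h0]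
  have ht : weightMeasure w B ≠ ∞ := h.weightMeasure_closedBall_ne_top hτ1 hw c hr
  set m := weightMeasure w B / volume B with hm
  have hm0 : m ≠ 0 := ENNReal.div_ne_zero.2 ⟨h0, hVt⟩
  have hmt : m ≠ ∞ := ENNReal.div_ne_top ht hV0
  have hσ := setLIntegral_rpow_neg_le (S := S) (t := S⁻¹) (B := B) hδ hβ1 hmt hw
    -- The decay is indexed one step behind the threshold `β^{-(k+1)}`; the prefactor `S = s`
    -- absorbs this shift and also covers the trivial layer `k = 0`.
    (fun k => by
      rcases k with _ | k
      · simpa using le_mul_of_one_le_left' (by simpa [hS] using hs.le)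
      · have := volume_sublevel_le hs0 hw (hiter k) hτ1 hr h0 ht
        have hSk : S * S⁻¹ ^ (k + 1) = S⁻¹ ^ k := by
          rw [pow_succ', ← mul_assoc, ENNReal.mul_inv_cancel hS0 hSt, one_mul]
        simp only [hSk, Nat.add_eq_zero_iff, one_ne_zero, and_false, false_or]
        exact this)
  calc m * ((∫⁻ x in B, (w x : ℝ≥0∞) ^ (-δ)) / volume B) ^ (1 / δ)
      ≤ m * (m ^ (-δ) * G) ^ (1 / δ) := by
        gcongr
        exact ENNReal.div_le_of_le_mul hσ
    _ = m * (m⁻¹ * G ^ (1 / δ)) := by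
        rw [ENNReal.mul_rpow_of_nonneg _ _ (by positivity), ← ENNReal.rpow_mul,
          neg_mul, mul_one_div_cancel hδ.ne', ENNReal.rpow_neg_one]
    _ = G ^ (1 / δ) := by
        rw [← mul_assoc, ENNReal.mul_inv_cancel hm0 hmt, one_mul]

/-! ### Change of representative and conclusion -/

lemma weightMeasure_congr {w v : (Fin n → ℝ) → ℝ≥0} (h : w =ᵐ[volume] v) :
    weightMeasure w = weightMeasure v :=
  withDensity_congr_ae (h.mono fun x hx => by simp only [hx])

lemma IsAInfty.congr {w v : (Fin n → ℝ) → ℝ≥0} (h : w =ᵐ[volume] v) (hw : IsAInfty w) :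
    IsAInfty v := by
  obtain ⟨q, hq⟩ := hw
  refine ⟨q, ?_⟩
  have h1 : A1Const w = A1Const v := by
    unfold A1Const
    refine iSup_congr fun Q => iSup_congr fun _ => ?_
    rw [weightMeasure_congr h, essSup_congr_ae
      ((ae_restrict_of_ae h).mono fun x hx => congrArg (fun y : ℝ≥0 => (y : ℝ≥0∞)⁻¹) hx)]
  have h2 : ApConst q w = ApConst q v := by
    unfold ApConst
    refine iSup_congr fun Q => iSup_congr fun _ => ?_
    rw [weightMeasure_congr h, lintegral_congr_ae ((ae_restrict_of_ae h).mono fun x hx =>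
      congrArg (fun y : ℝ≥0 => (y : ℝ≥0∞) ^ (-1 / (q - 1))) hx)]
  rwa [IsAp, ← h1, ← h2]

lemma BoundedOnLp.congr {τ p : ℝ} {w v : (Fin n → ℝ) → ℝ≥0} (h : w =ᵐ[volume] v)
    (hw : BoundedOnLp τ p w) : BoundedOnLp τ p v := by
  rwa [BoundedOnLp, ← weightMeasure_congr h]

end MedianMaximal

end

theorem mainTheorem2 (n : ℕ) (hn : 1 ≤ n) (τ : ℝ) (hτ : τ ∈ Set.Ioo (0 : ℝ) 1)
    (p : ℝ) (hp : 0 < p) (w : (Fin n → ℝ) → ℝ≥0) (hw : AEMeasurable w volume) :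
    MedianMaximal.BoundedOnLp τ p w ↔ MedianMaximal.IsAInfty w := by
  refine ⟨fun h => ?_, fun h => h.boundedOnLp hw hτ.1 hp⟩
  -- A Borel version of `w` makes its sublevel sets admissible in `SubsetBound`.
  obtain ⟨K, hK⟩ := (h.congr hw.ae_eq_mk).subsetBound hp
  exact (hK.isAInfty hτ.1 hτ.2 hw.measurable_mk).congr hw.ae_eq_mk.symm
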